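/- An ordered graph is a finite simple graph together with a linear order on its vertex set (the empty graph is allowed). A monotone property of ordered graphs is a collection $\mathcal{P}$ of ordered graphs that is closed under order-preserving isomorphism and under taking subgraphs (with the induced vertex order). Write $\mathcal{P}_n$ for the set of isomorphism classes of ordered graphs on $n$ vertices in $\mathcal{P}$; the function $n \mapsto |\mathcal{P}_n|$ is the speed of $\mathcal{P}$. Let $\mathcal{P}^{(1,2)}$ be the collection of those $G \in \mathcal{P}$ in which every vertex lies in at most one edge (and every edge has at most two vertices, which is automatic for graphs). For a permutation $\pi$ of $[k] = \{1,\dots,k\}$ let $H(\pi)$ be the ordered graph with vertex set $[2k]$ and edge set $\{\{i, \pi(i)+k\} : i \in [k]\}$. **Theorem.** Let $\mathcal{P}$ be a monotone property of ordered graphs. If for every constant $c > 0$ there exists an $N = N(c) \in \mathbb{N}$ such that $|\mathcal{P}_N| > c^N$, then $\mathcal{P}$ contains the ordered graph $H(\pi)$ for every permutation $\pi$ of $[k]$ and every $k$, and $$|\mathcal{P}_n| \;\geqslant\; |\mathcal{P}^{(1,2)}_n| \;\geqslant\; \sum_{k=0}^{\lfloor n/2 \rfloor} \binom{n}{2k}\,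 k! \;=\; n^{n/2+o(n)}$$ for every $n \in \mathbb{N}$ (the last equality for $n \geqslant 1$, with $o(n)$ as $n \to \infty$). This lower bound is best possible: there is a monotone property of ordered graphs that satisfies the hypothesis and has $|\mathcal{P}_n| = \sum_{k=0}^{\lfloor n/2 \rfloor} \binom{n}{2k} k!$ for every $n$. Moreover, there is exactly one monotone property of ordered graphs with this speed. -/

import Mathlib

/-- A (finite) ordered graph: a simple graph on a finite vertex set together with a linear order
on the vertices. -/
structure OrderedGraph where
  /-- the vertex set -/
  V : Type
  [linearOrder : LinearOrder V]
  [finite : Finite V]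
  /-- the graph on the vertex set -/
  graph : SimpleGraph V

attribute [instance] OrderedGraph.linearOrder OrderedGraph.finite

namespace OrderedGraph

/-- Two ordered graphs are isomorphic if some order isomorphism of the vertex sets preserves
adjacency and non-adjacency. -/
def Isomorphic (G H : OrderedGraph) : Prop :=
  ∃ e : G.V ≃o H.V, ∀ a b : G.V, G.graph.Adj a b ↔ H.graph.Adj (e a) (e b)

theorem Isomorphic.refl (G : OrderedGraph) : Isomorphic G G :=
  ⟨OrderIso.refl G.V, fun _ _ => Iff.rfl⟩

theorem Isomorphic.symm {G H : OrderedGraph} (h : Isomorphic G H) : Isomorphic H G := by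
  obtain ⟨e, he⟩ := h
  refine ⟨e.symm, fun a b => ?_⟩
  rw [he, OrderIso.apply_symm_apply, OrderIso.apply_symm_apply]

theorem Isomorphic.trans {G H K : OrderedGraph} (h : Isomorphic G H) (h' : Isomorphic H K) :
    Isomorphic G K := by
  obtain ⟨e, he⟩ := h
  obtain ⟨f, hf⟩ := h'
  exact ⟨e.trans f, fun a b => (he a b).trans (hf _ _)⟩

/-- Isomorphism of ordered graphs as an equivalence relation. -/
def isoSetoid : Setoid OrderedGraph where
  r := Isomorphic
  iseqv := ⟨Isomorphic.refl, Isomorphic.symm, Isomorphic.trans⟩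

/-- The ordered graph formed by a subgraph `S` of `G` (any vertex subset `U`, any set of edges
of `G` inside `U`), with the induced order on its vertices. -/
def ofSubgraph (G : OrderedGraph) (S : G.graph.Subgraph) : OrderedGraph where
  V := S.verts
  graph := S.coe

/-- A property of ordered graphs: a collection closed under order-preserving isomorphism. -/
def IsProperty (P : Set OrderedGraph) : Prop :=
  ∀ G ∈ P, ∀ H : OrderedGraph, Isomorphic G H → H ∈ P

/-- A monotone property of ordered graphs: a property closed under taking subgraphs. -/
def IsMonotone (P : Set OrderedGraph) : Prop :=
  IsProperty P ∧ ∀ G ∈ P, ∀ S : G.graph.Subgraph, G.ofSubgraph S ∈ P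

/-- `P_n`: the isomorphism classes of the ordered graphs on `n` vertices in `P`. -/
def isoClasses (P : Set OrderedGraph) (n : ℕ) : Set (Quotient isoSetoid) :=
  {q | ∃ G ∈ P, Nat.card G.V = n ∧ Quotient.mk isoSetoid G = q}

/-- There are finitely many isomorphism classes on `n` vertices, so that counting them with
`Set.ncard` is meaningful. -/
theorem finite_isoClasses (P : Set OrderedGraph) (n : ℕ) : (isoClasses P n).Finite := by
  refine (Set.finite_range fun G : SimpleGraph (Fin n) =>
    Quotient.mk isoSetoid (⟨Fin n, G⟩ : OrderedGraph)).subset ?_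
  rintro q ⟨G, -, hn, rfl⟩
  have : Fintype G.V := Fintype.ofFinite G.V
  have e : Fin n ≃o G.V := Fintype.orderIsoFinOfCardEq G.V (by rw [← hn, Nat.card_eq_fintype_card])
  exact ⟨G.graph.comap e, Quotient.sound ⟨e, fun a b => Iff.rfl⟩⟩

/-- The (unlabelled) speed `n ↦ |P_n|` of `P`. -/
noncomputable def speed (P : Set OrderedGraph) (n : ℕ) : ℕ :=
  (isoClasses P n).ncard

/-- The sub-property `P^{(k,ℓ)}` of those members of `P` in which each vertex lies in at most `k`
edges and each edge has at most `ℓ` vertices. -/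
def restrict (P : Set OrderedGraph) (k l : ℕ∞) : Set OrderedGraph :=
  {G ∈ P | (∀ v : G.V, (G.graph.incidenceSet v).encard ≤ k) ∧
    ∀ e ∈ G.graph.edgeSet, {v : G.V | v ∈ e}.encard ≤ l}

/-- `P` has super-exponential speed: for every `c > 0` there is an `N` with `|P_N| > c ^ N`. -/
def SuperExponential (P : Set OrderedGraph) : Prop :=
  ∀ c : ℝ, 0 < c → ∃ N : ℕ, c ^ N < (speed P N : ℝ)

/-- The ordered graph `H(π)` of a permutation `π` of `k` points: the vertices are `0, …, 2k - 1` in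
their natural order and the edges are `{i, π(i) + k}` for `0 ≤ i < k`. -/
def H {k : ℕ} (π : Equiv.Perm (Fin k)) : OrderedGraph where
  V := Fin (2 * k)
  graph := SimpleGraph.fromEdgeSet (Set.range fun i : Fin k =>
    s((⟨i, by omega⟩ : Fin (2 * k)), (⟨π i + k, by omega⟩ : Fin (2 * k))))

/-- The number `∑_{k = 0}^{⌊n/2⌋} C(n, 2k) k!`. -/
def minSpeed (n : ℕ) : ℕ :=
  ∑ k ∈ Finset.range (n / 2 + 1), n.choose (2 * k) * k.factorial

end OrderedGraph

/-! ### 0-1 matrices avoiding a permutation: the Marcus–Tardos and Klazar theorems. -/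

namespace PermPattern

open Finset

/-! Encode an ordered graph by the ones above the diagonal of its adjacency matrix. Border the
matrix of π by a one in a new bottom-left corner (`cornerPerm`). If the graph's matrix contains this
pattern, the corner, being above the diagonal, puts all the rows used before all the columns used,
so the graph contains H(π). Hence if P misses some H(π), its matrices avoid a fixed permutation. By
Klazar's theorem (`exists_card_avoiders_le`), deduced from the Marcus–Tardos bound
(`exists_card_le`) by contracting blocks, their number is at most exponential. So super-exponential
speed forces every H(π) into P.

The ordered subgraphs of the H(π) are, up to isomorphism, the crossing matchings: matchings whose
left ends all precede all right ends. One on n vertices is given by its 2k non-isolated vertices and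
a bijection from the first k to the last k of them, so `minSpeed n` counts them. They form a
monotone property inside P^{(1,2)}, which gives the lower bound and its sharpness.

For uniqueness, `minSpeed n` is at least ⌊n/2⌋!, so a monotone property with this speed is
super-exponential and contains all crossing matchings; equal finite counts leave room for nothing
else. -/

theorem card_le_mul_of_forall_fiber {α β : Type*} [DecidableEq β] (S : Finset α) (f : α → β)
    (T : Finset β) (N : ℕ) (h : ∀ a ∈ S, f a ∈ T) (hN : ∀ b ∈ T, #{a ∈ S | f a = b} ≤ N) :
    #S ≤ N * #T :=
  Finset.card_le_mul_card_image_of_maps_to h N hN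

/-- The 0-1 matrix whose ones are the positions in `A` contains the permutation matrix of `σ`. -/
def Contains {k : ℕ} (σ : Equiv.Perm (Fin k)) (A : Finset (ℕ × ℕ)) : Prop :=
  ∃ r c : Fin k → ℕ, StrictMono r ∧ StrictMono c ∧ ∀ i, (r i, c (σ i)) ∈ A

theorem Contains.swap {k : ℕ} {σ : Equiv.Perm (Fin k)} {A : Finset (ℕ × ℕ)}
    (h : Contains σ⁻¹ (A.image Prod.swap)) : Contains σ A := by
  obtain ⟨r, c, hr, hc, h⟩ := h
  refine ⟨c, r, hc, hr, fun i => ?_⟩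
  have := h (σ i)
  obtain ⟨p, hp, hpe⟩ := mem_image.1 this
  rw [Equiv.Perm.inv_def, Equiv.symm_apply_apply] at hpe
  rwa [show (c i, r (σ i)) = p from Prod.swap_injective hpe.symm]

/-- The block of side `s` that contains a position. -/
def block (s : ℕ) (p : ℕ × ℕ) : ℕ × ℕ := (p.1 / s, p.2 / s)

theorem strictMono_of_div {k s : ℕ} {r r' : Fin k → ℕ} (hr : StrictMono r)
    (h : ∀ i, r' i / s = r i) : StrictMono r' := by
  intro i j hij
  have := hr hij
  rw [← h, ← h] at this
  exact lt_of_not_ge fun hle => absurd (Nat.div_le_div_right (c := s) hle) (not_le.2 this)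

/-- The k blocks of a pattern lie in distinct block rows and block columns, so one position chosen
in each keeps their relative order. -/
theorem Contains.of_image_block {k s : ℕ} {σ : Equiv.Perm (Fin k)} {A : Finset (ℕ × ℕ)}
    (h : Contains σ (A.image (block s))) : Contains σ A := by
  obtain ⟨r, c, hr, hc, h⟩ := h
  simp only [mem_image] at h
  choose p hpA hp using h
  refine ⟨fun i => (p i).1, fun j => (p (σ.symm j)).2, strictMono_of_div (s := s) hr fun i => ?_,
    strictMono_of_div (s := s) hc fun j => ?_, fun i => ?_⟩
  · exact congrArg Prod.fst (hp i)
  · have h1 : (p (σ.symm j)).2 / s = c (σ (σ.symm j)) := congrArg Prod.snd (hp (σ.symm j))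
    rwa [σ.apply_symm_apply] at h1
  · simpa using hpA i

/-- In each column of blocks of an avoiding matrix there are few blocks with ones in at least `k`
columns. -/
theorem card_wide_column_le {k s : ℕ} {σ : Equiv.Perm (Fin k)} {A : Finset (ℕ × ℕ)}
    (hs : 0 < s) (hA : ¬ Contains σ A) (I : Finset ℕ) (j : ℕ)
    (hI : ∀ i ∈ I, k ≤ #({p ∈ A | block s p = (i, j)}.image Prod.snd)) : #I ≤ k * 2 ^ s := by
  classical
  have hex : ∀ i : ℕ, ∃ Y : Finset ℕ, i ∈ I →
      Y ⊆ ({p ∈ A | block s p = (i, j)}.image Prod.snd) ∧ #Y = k := fun i => by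
    by_cases hi : i ∈ I
    · obtain ⟨Y, hY⟩ := exists_subset_card_eq (hI i hi)
      exact ⟨Y, fun _ => hY⟩
    · exact ⟨∅, fun h => absurd h hi⟩
  choose Y hY using hex
  have hmaps : ∀ i ∈ I, Y i ∈ (Ico (s * j) (s * j + s)).powerset := by
    intro i hi
    rw [mem_powerset]
    intro y hy
    obtain ⟨p, hp, rfl⟩ := mem_image.1 ((hY i hi).1 hy)
    have hpj : p.2 / s = j := congrArg Prod.snd (mem_filter.1 hp).2
    rw [mem_Ico, ← hpj]
    have h1 := Nat.div_add_mod p.2 s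
    have h2 := Nat.mod_lt p.2 hs
    omega
  have := card_le_mul_of_forall_fiber I Y _ k hmaps ?_
  · simpa using this
  -- Pigeonhole on column sets: if k blocks of one block column have ones in the same k columns `T`,
  -- then the a-th block can supply a one in column σ(a) of `T`, which yields σ.
  intro T _
  by_contra! hlt
  apply hA
  obtain ⟨J, hJ, hJk⟩ := exists_subset_card_eq hlt.le
  have hJI : ∀ a : Fin k, J.orderEmbOfFin hJk a ∈ I ∧ Y (J.orderEmbOfFin hJk a) = T := fun a =>
    mem_filter.1 (hJ (J.orderEmbOfFin_mem hJk a))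
  rcases Nat.eq_zero_or_pos k with rfl | hk
  · exact ⟨Fin.elim0, Fin.elim0, fun a => a.elim0, fun a => a.elim0, fun a => a.elim0⟩
  have hT : #T = k := by
    rw [← (hJI ⟨0, hk⟩).2]
    exact (hY _ (hJI ⟨0, hk⟩).1).2
  have hone : ∀ a : Fin k, ∃ p ∈ A, block s p = (J.orderEmbOfFin hJk a, j) ∧
      p.2 = T.orderEmbOfFin hT (σ a) := by
    intro a
    have h1 := (hY _ (hJI a).1).1
    rw [(hJI a).2] at h1
    obtain ⟨p, hp, hp2⟩ := mem_image.1 (h1 (T.orderEmbOfFin_mem hT (σ a)))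
    exact ⟨p, (mem_filter.1 hp).1, (mem_filter.1 hp).2, hp2⟩
  choose p hpA hpb hp2 using hone
  refine ⟨fun a => (p a).1, T.orderEmbOfFin hT,
    strictMono_of_div (s := s) (J.orderEmbOfFin hJk).strictMono fun a =>
      congrArg Prod.fst (hpb a), (T.orderEmbOfFin hT).strictMono, fun a => ?_⟩
  rw [← hp2]
  exact hpA a

theorem card_wide_le {k s n : ℕ} {σ : Equiv.Perm (Fin k)} {A : Finset (ℕ × ℕ)}
    (hs : 0 < s) (hA : ¬ Contains σ A) (B : Finset (ℕ × ℕ)) (hB : ∀ b ∈ B, b.2 < n)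
    (hBw : ∀ b ∈ B, k ≤ #({p ∈ A | block s p = b}.image Prod.snd)) :
    #B ≤ k * 2 ^ s * n := by
  have := card_le_mul_of_forall_fiber B Prod.snd (range n) (k * 2 ^ s)
    (fun b hb => mem_range.2 (hB b hb)) fun j _ => ?_
  · simpa using this
  rw [← card_image_of_injOn (f := Prod.fst)]
  · refine card_wide_column_le hs hA _ j fun i hi => ?_
    obtain ⟨b, hb, rfl⟩ := mem_image.1 hi
    obtain ⟨hbB, rfl⟩ := mem_filter.1 hb
    exact hBw b hbB
  · intro a ha b hb hab
    have h1 := (mem_filter.1 ha).2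
    have h2 := (mem_filter.1 hb).2
    exact Prod.ext hab (h1.trans h2.symm)

/-- Transposition exchanges wide and tall blocks and replaces σ by its inverse. -/
theorem card_tall_le {k s n : ℕ} {σ : Equiv.Perm (Fin k)} {A : Finset (ℕ × ℕ)}
    (hs : 0 < s) (hA : ¬ Contains σ A) (B : Finset (ℕ × ℕ)) (hB : ∀ b ∈ B, b.1 < n)
    (hBw : ∀ b ∈ B, k ≤ #({p ∈ A | block s p = b}.image Prod.fst)) :
    #B ≤ k * 2 ^ s * n := by
  rw [← card_image_of_injective B Prod.swap_injective]
  refine card_wide_le hs (fun h => hA h.swap) _ ?_ ?_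
  · intro b hb
    obtain ⟨b, hbB, rfl⟩ := mem_image.1 hb
    exact hB b hbB
  · intro b hb
    obtain ⟨b, hbB, rfl⟩ := mem_image.1 hb
    refine (hBw b hbB).trans (card_le_card ?_)
    intro x hx
    obtain ⟨p, hp, rfl⟩ := mem_image.1 hx
    obtain ⟨hpA, rfl⟩ := mem_filter.1 hp
    exact mem_image.2 ⟨p.swap, mem_filter.2 ⟨mem_image_of_mem _ hpA, rfl⟩, rfl⟩

theorem card_filter_block_le {s : ℕ} (hs : 0 < s) (A : Finset (ℕ × ℕ)) (b : ℕ × ℕ) :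
    #{p ∈ A | block s p = b} ≤ s ^ 2 := by
  have : {p ∈ A | block s p = b} ⊆
      Ico (s * b.1) (s * b.1 + s) ×ˢ Ico (s * b.2) (s * b.2 + s) := by
    intro p hp
    obtain ⟨-, rfl⟩ := mem_filter.1 hp
    simp only [block, mem_product, mem_Ico]
    have h1 := Nat.div_add_mod p.1 s
    have h2 := Nat.mod_lt p.1 hs
    have h3 := Nat.div_add_mod p.2 s
    have h4 := Nat.mod_lt p.2 hs
    omega
  refine (card_le_card this).trans ?_
  simp [sq]

theorem image_block_subset {s n : ℕ} {A : Finset (ℕ × ℕ)}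
    (hA : A ⊆ range (s * n) ×ˢ range (s * n)) : A.image (block s) ⊆ range n ×ˢ range n := by
  intro b hb
  obtain ⟨p, hp, rfl⟩ := mem_image.1 hb
  have := hA hp
  simp only [mem_product, mem_range] at this
  simp only [block, mem_product, mem_range]
  exact ⟨Nat.div_lt_of_lt_mul this.1, Nat.div_lt_of_lt_mul this.2⟩

/-- The Marcus–Tardos recursion: a block neither wide nor tall meets fewer than k rows and k
columns, so it holds at most k² ones. Wide and tall blocks are few, and the trivial bound s²
suffices for them. -/
theorem card_le_card_image_block {k s n : ℕ} {σ : Equiv.Perm (Fin k)} {A : Finset (ℕ × ℕ)}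
    (hs : 0 < s) (hA : ¬ Contains σ A) (hAn : A ⊆ range (s * n) ×ˢ range (s * n)) :
    #A ≤ k ^ 2 * #(A.image (block s)) + 2 * (s ^ 2 * (k * 2 ^ s * n)) := by
  classical
  set A' := A.image (block s) with hA'
  have hsub := image_block_subset hAn
  set W := {b ∈ A' | k ≤ #({p ∈ A | block s p = b}.image Prod.snd)} with hW
  set T := {b ∈ A' | k ≤ #({p ∈ A | block s p = b}.image Prod.fst)} with hT
  have hWc : #W ≤ k * 2 ^ s * n := card_wide_le hs hA W
    (fun b hb => mem_range.1 (mem_product.1 (hsub (mem_filter.1 hb).1)).2)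
    fun b hb => (mem_filter.1 hb).2
  have hTc : #T ≤ k * 2 ^ s * n := card_tall_le hs hA T
    (fun b hb => mem_range.1 (mem_product.1 (hsub (mem_filter.1 hb).1)).1)
    fun b hb => (mem_filter.1 hb).2
  have hpt : ∀ b ∈ A', #{p ∈ A | block s p = b} ≤
      k ^ 2 + ((if k ≤ #({p ∈ A | block s p = b}.image Prod.snd) then s ^ 2 else 0) +
        if k ≤ #({p ∈ A | block s p = b}.image Prod.fst) then s ^ 2 else 0) := by
    intro b _
    have h0 := card_filter_block_le hs A b
    by_cases h1 : k ≤ #({p ∈ A | block s p = b}.image Prod.snd)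
    · rw [if_pos h1]; omega
    by_cases h2 : k ≤ #({p ∈ A | block s p = b}.image Prod.fst)
    · rw [if_pos h2]; omega
    rw [if_neg h1, if_neg h2, add_zero, add_zero]
    have h3 : {p ∈ A | block s p = b} ⊆ ({p ∈ A | block s p = b}.image Prod.fst) ×ˢ
        ({p ∈ A | block s p = b}.image Prod.snd) := fun p hp =>
      mem_product.2 ⟨mem_image_of_mem _ hp, mem_image_of_mem _ hp⟩
    refine (card_le_card h3).trans ?_
    rw [card_product, sq]
    exact Nat.mul_le_mul (not_le.1 h2).le (not_le.1 h1).le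
  calc #A = ∑ b ∈ A', #{p ∈ A | block s p = b} :=
        card_eq_sum_card_image (block s) A
    _ ≤ _ := sum_le_sum hpt
    _ = k ^ 2 * #A' + (#W * s ^ 2 + #T * s ^ 2) := by
        rw [sum_add_distrib, sum_add_distrib, ← sum_filter, ← sum_filter, sum_const, sum_const,
          sum_const, smul_eq_mul, smul_eq_mul, smul_eq_mul, mul_comm]
    _ ≤ _ := by
        have h1 := Nat.mul_le_mul_right (s ^ 2) hWc
        have h2 := Nat.mul_le_mul_right (s ^ 2) hTc
        rw [mul_comm _ (s ^ 2)] at h1 h2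
        rw [mul_comm _ (s ^ 2)] at h1 h2
        linarith

/-- The Marcus–Tardos theorem, for matrices whose side is a power of some `s > k ^ 2`. -/
theorem exists_card_le {k s : ℕ} (σ : Equiv.Perm (Fin k)) (hs : k ^ 2 + 1 ≤ s) :
    ∃ C : ℕ, ∀ (m : ℕ) (A : Finset (ℕ × ℕ)), ¬ Contains σ A →
      A ⊆ range (s ^ m) ×ˢ range (s ^ m) → #A ≤ C * s ^ m := by
  -- The main term absorbs the wide and tall blocks; the 1 covers the 1 × 1 matrix.
  obtain ⟨C, hC⟩ : ∃ C, C = 2 * (s ^ 2 * (k * 2 ^ s)) + 1 := ⟨_, rfl⟩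
  refine ⟨C, fun m => ?_⟩
  induction m with
  | zero =>
    intro A _ hAn
    have := card_le_card hAn
    simp at this
    simp only [pow_zero, mul_one]
    omega
  | succ m ih =>
    intro A hA hAn
    rw [pow_succ'] at hAn
    have h1 := card_le_card_image_block (by omega) hA hAn
    have h2 := ih (A.image (block s)) (fun h => hA h.of_image_block) (image_block_subset hAn)
    have h3 := Nat.mul_le_mul_left (k ^ 2) h2
    have h4 : 2 * (s ^ 2 * (k * 2 ^ s * s ^ m)) ≤ C * s ^ m := by
      rw [hC, add_mul]
      exact le_of_eq_of_le (by ring) (Nat.le_add_right _ _)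
    calc #A ≤ k ^ 2 * (C * s ^ m) + C * s ^ m := by omega
      _ = (k ^ 2 + 1) * (C * s ^ m) := by ring
      -- The choice of s makes the factor k² + 1 of the recursion no larger than the growth s of the
      -- side.
      _ ≤ s * (C * s ^ m) := Nat.mul_le_mul_right _ hs
      _ = C * s ^ (m + 1) := by ring

open Classical in
/-- The `n × n` matrices that avoid `σ`. -/
noncomputable def avoiders {k : ℕ} (σ : Equiv.Perm (Fin k)) (n : ℕ) : Finset (Finset (ℕ × ℕ)) :=
  {A ∈ (range n ×ˢ range n).powerset | ¬ Contains σ A}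

theorem mem_avoiders {k : ℕ} {σ : Equiv.Perm (Fin k)} {n : ℕ} {A : Finset (ℕ × ℕ)} :
    A ∈ avoiders σ n ↔ A ⊆ range n ×ˢ range n ∧ ¬ Contains σ A := by
  simp [avoiders]

theorem avoiders_mono {k : ℕ} (σ : Equiv.Perm (Fin k)) {m n : ℕ} (h : m ≤ n) :
    avoiders σ m ⊆ avoiders σ n := by
  intro A hA
  rw [mem_avoiders] at hA ⊢
  exact ⟨hA.1.trans (product_subset_product (range_mono h) (range_mono h)), hA.2⟩

/-- Once the contracted matrix B is known, A is a subset of the s²·#B cells in the blocks of B. -/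
theorem card_avoiders_mul_le {k s n N : ℕ} (σ : Equiv.Perm (Fin k)) (hs : 0 < s)
    (hN : ∀ A ∈ avoiders σ n, #A ≤ N) :
    #(avoiders σ (s * n)) ≤ 2 ^ (s ^ 2 * N) * #(avoiders σ n) := by
  refine card_le_mul_of_forall_fiber _ (fun A => A.image (block s)) _ _ ?_ ?_
  · intro A hA
    rw [mem_avoiders] at hA ⊢
    exact ⟨image_block_subset hA.1, fun h => hA.2 h.of_image_block⟩
  · intro B hB
    have hsub : {A ∈ avoiders σ (s * n) | A.image (block s) = B} ⊆
        {p ∈ range (s * n) ×ˢ range (s * n) | block s p ∈ B}.powerset := by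
      intro A hA
      obtain ⟨hAv, hAB⟩ := mem_filter.1 hA
      rw [mem_powerset]
      intro p hp
      refine mem_filter.2 ⟨(mem_avoiders.1 hAv).1 hp, ?_⟩
      rw [← hAB]
      exact mem_image_of_mem _ hp
    refine (card_le_card hsub).trans ?_
    rw [card_powerset]
    refine Nat.pow_le_pow_right two_pos ?_
    refine (card_le_mul_of_forall_fiber _ (block s) B (s ^ 2)
      (fun p hp => (mem_filter.1 hp).2) fun b _ => card_filter_block_le hs _ b).trans ?_
    exact Nat.mul_le_mul_left _ (hN B hB)

/-- Klazar's theorem: there are only exponentially many matrices that avoid a permutation. -/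
theorem exists_card_avoiders_le {k : ℕ} (σ : Equiv.Perm (Fin k)) :
    ∃ c : ℕ, 0 < c ∧ ∀ n : ℕ, #(avoiders σ n) ≤ c ^ n := by
  -- One more than Marcus–Tardos needs: 2 ≤ s lets the exponents telescope below and makes `Nat.log
  -- s` usable.
  obtain ⟨s, hs⟩ : ∃ s, s = k ^ 2 + 2 := ⟨_, rfl⟩
  obtain ⟨C, hC⟩ := exists_card_le (s := s) σ (by omega)
  obtain ⟨D, hD⟩ : ∃ D, D = s ^ 2 * C + 1 := ⟨_, rfl⟩
  have hpow : ∀ m : ℕ, #(avoiders σ (s ^ m)) ≤ 2 ^ (D * s ^ m) := by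
    intro m
    induction m with
    | zero =>
      have h1 : avoiders σ (s ^ 0) ⊆ (range 1 ×ˢ range 1).powerset := fun A hA =>
        mem_powerset.2 (mem_avoiders.1 hA).1
      refine (card_le_card h1).trans ?_
      rw [card_powerset]
      refine Nat.pow_le_pow_right two_pos ?_
      simp [hD]
    | succ m ih =>
      rw [pow_succ']
      refine (card_avoiders_mul_le σ (by omega) fun A hA =>
        hC m A (mem_avoiders.1 hA).2 (mem_avoiders.1 hA).1).trans ?_
      refine (Nat.mul_le_mul_left _ ih).trans ?_
      rw [← pow_add]
      refine Nat.pow_le_pow_right two_pos ?_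
      calc s ^ 2 * (C * s ^ m) + D * s ^ m ≤ D * s ^ m + D * s ^ m := by
            refine Nat.add_le_add_right ?_ _
            rw [← mul_assoc]
            exact Nat.mul_le_mul_right _ (by omega)
        _ = 2 * (D * s ^ m) := by ring
        _ ≤ s * (D * s ^ m) := Nat.mul_le_mul_right _ (by omega)
        _ = D * (s * s ^ m) := by ring
  -- Rounding n up to a power of s costs at most a factor s.
  refine ⟨2 ^ (D * s), by positivity, fun n => ?_⟩
  rcases Nat.eq_zero_or_pos n with rfl | hn
  · have h1 : avoiders σ 0 ⊆ {∅} := fun A hA => by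
      simpa using (mem_avoiders.1 hA).1
    simpa using card_le_card h1
  · have hs1 : 1 < s := by omega
    refine (card_le_card (avoiders_mono σ (Nat.lt_pow_succ_log_self hs1 n).le)).trans
      ((hpow _).trans ?_)
    rw [← pow_mul]
    refine Nat.pow_le_pow_right two_pos ?_
    rw [pow_succ', ← mul_assoc]
    exact Nat.mul_le_mul_left _ (Nat.pow_log_le_self s hn.ne')

end PermPattern

/-! ### From ordered graphs to matrices: super-exponential speed forces every H(π). -/

namespace OrderedGraph

theorem mem_of_embedding {P : Set OrderedGraph} (hP : IsMonotone P) {G H : OrderedGraph}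
    (hH : H ∈ P) (f : G.V → H.V) (hf : StrictMono f)
    (hadj : ∀ a b, G.graph.Adj a b → H.graph.Adj (f a) (f b)) : G ∈ P := by
  let S : H.graph.Subgraph :=
    { verts := Set.range f
      Adj := fun x y => ∃ a b, f a = x ∧ f b = y ∧ G.graph.Adj a b
      adj_sub := by
        rintro _ _ ⟨a, b, rfl, rfl, h⟩
        exact hadj a b h
      edge_vert := by
        rintro _ _ ⟨a, b, rfl, rfl, h⟩
        exact ⟨a, rfl⟩
      symm := ⟨by
        rintro _ _ ⟨a, b, rfl, rfl, h⟩
        exact ⟨b, a, rfl, rfl, h.symm⟩⟩ }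
  have hiso : Isomorphic G (H.ofSubgraph S) := by
    refine ⟨hf.orderIso f, fun a b => ⟨fun h => ⟨a, b, rfl, rfl, h⟩, ?_⟩⟩
    rintro ⟨a', b', ha, hb, h⟩
    rwa [← hf.injective ha, ← hf.injective hb]
  exact hP.1 _ (hP.2 H hH S) _ hiso.symm

/-- A graph on `Fin n` as an ordered graph. -/
def ofFin {n : ℕ} (G : SimpleGraph (Fin n)) : OrderedGraph where
  V := Fin n
  graph := G

/-- The graphs on `Fin n` that belong to `P` with the usual order of `Fin n`. -/
def finGraphs (P : Set OrderedGraph) (n : ℕ) : Set (SimpleGraph (Fin n)) :=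
  {G | ofFin G ∈ P}

theorem exists_isomorphic_ofFin (G : OrderedGraph) :
    ∃ G' : SimpleGraph (Fin (Nat.card G.V)), Isomorphic G (ofFin G') := by
  have : Fintype G.V := Fintype.ofFinite G.V
  have e : Fin (Nat.card G.V) ≃o G.V :=
    Fintype.orderIsoFinOfCardEq G.V Nat.card_eq_fintype_card.symm
  exact ⟨G.graph.comap e, Isomorphic.symm ⟨e, fun a b => Iff.rfl⟩⟩

theorem eq_of_isomorphic_ofFin {n : ℕ} {G G' : SimpleGraph (Fin n)}
    (h : Isomorphic (ofFin G) (ofFin G')) : G = G' := by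
  obtain ⟨e, he⟩ := h
  have h1 : (e : Fin n ≃o Fin n) = OrderIso.refl (Fin n) := Subsingleton.elim _ _
  ext a b
  have h2 : G.Adj a b ↔ G'.Adj ((e : Fin n ≃o Fin n) a) ((e : Fin n ≃o Fin n) b) := he a b
  rwa [h1] at h2

/-- `Fin n` has no nontrivial order automorphism, so isomorphism classes are the same as labelled
graphs. -/
theorem speed_eq_ncard_finGraphs {P : Set OrderedGraph} (hP : IsProperty P) (n : ℕ) :
    speed P n = (finGraphs P n).ncard := by
  have hinj : Function.Injective
      fun G : SimpleGraph (Fin n) => Quotient.mk isoSetoid (ofFin G) := fun G G' h =>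
    eq_of_isomorphic_ofFin (Quotient.exact h)
  rw [speed, ← Set.ncard_image_of_injective _ hinj]
  congr 1
  ext q
  constructor
  · rintro ⟨G, hG, rfl, rfl⟩
    obtain ⟨G', h⟩ := exists_isomorphic_ofFin G
    exact ⟨G', hP G hG _ h, Quotient.sound h.symm⟩
  · rintro ⟨G, hG, rfl⟩
    exact ⟨ofFin G, hG, Nat.card_fin n, rfl⟩

theorem speed_mono {P Q : Set OrderedGraph} (h : P ⊆ Q) (n : ℕ) : speed P n ≤ speed Q n := by
  refine Set.ncard_le_ncard ?_ (finite_isoClasses Q n)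
  rintro q ⟨G, hG, hq⟩
  exact ⟨G, h hG, hq⟩

theorem H_adj {k : ℕ} {π : Equiv.Perm (Fin k)} {x y : Fin (2 * k)} :
    (H π).graph.Adj x y ↔ ∃ i : Fin k,
      ((x : ℕ) = i ∧ (y : ℕ) = π i + k) ∨ ((y : ℕ) = i ∧ (x : ℕ) = π i + k) := by
  refine (SimpleGraph.fromEdgeSet_adj _).trans ?_
  constructor
  · rintro ⟨⟨i, hi⟩, -⟩
    obtain ⟨rfl, rfl⟩ | ⟨rfl, rfl⟩ := Sym2.eq_iff.1 hi
    · exact ⟨i, Or.inl ⟨rfl, rfl⟩⟩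
    · exact ⟨i, Or.inr ⟨rfl, rfl⟩⟩
  · rintro ⟨i, ⟨h1, h2⟩ | ⟨h1, h2⟩⟩
    · refine ⟨⟨i, Sym2.eq_iff.2 (Or.inl ⟨Fin.ext h1.symm, Fin.ext h2.symm⟩)⟩, ?_⟩
      rintro rfl
      omega
    · refine ⟨⟨i, Sym2.eq_iff.2 (Or.inr ⟨Fin.ext h1.symm, Fin.ext h2.symm⟩)⟩, ?_⟩
      rintro rfl
      omega

/-- The permutation matrix of `π` with a further one in a new last row and a new first column. -/
def cornerPerm {k : ℕ} (π : Equiv.Perm (Fin k)) : Equiv.Perm (Fin (k + 1)) :=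
  (finSuccEquivLast.trans (Equiv.optionCongr π)).trans (finSuccEquiv k).symm

theorem cornerPerm_last {k : ℕ} (π : Equiv.Perm (Fin k)) : cornerPerm π (Fin.last k) = 0 := by
  simp [cornerPerm]

theorem cornerPerm_castSucc {k : ℕ} (π : Equiv.Perm (Fin k)) (i : Fin k) :
    cornerPerm π i.castSucc = (π i).succ := by
  simp [cornerPerm]

open Classical in
/-- The ones above the diagonal of the adjacency matrix. -/
noncomputable def upperMatrix {n : ℕ} (G : SimpleGraph (Fin n)) : Finset (ℕ × ℕ) :=
  ({p : Fin n × Fin n | p.1 < p.2 ∧ G.Adj p.1 p.2} : Finset (Fin n × Fin n)).image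
    fun p => ((p.1 : ℕ), (p.2 : ℕ))

theorem mem_upperMatrix {n : ℕ} {G : SimpleGraph (Fin n)} {x y : ℕ} :
    (x, y) ∈ upperMatrix G ↔ ∃ a b : Fin n, a < b ∧ G.Adj a b ∧ (a : ℕ) = x ∧ (b : ℕ) = y := by
  simp [upperMatrix, and_assoc]

theorem upperMatrix_injective (n : ℕ) :
    Function.Injective (upperMatrix : SimpleGraph (Fin n) → Finset (ℕ × ℕ)) := by
  intro G G' h
  have key : ∀ a b : Fin n, a < b → (G.Adj a b ↔ G'.Adj a b) := by
    have h1 : ∀ (K : SimpleGraph (Fin n)) (a b : Fin n), a < b →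
        (K.Adj a b ↔ ((a : ℕ), (b : ℕ)) ∈ upperMatrix K) := by
      intro K a b hab
      rw [mem_upperMatrix]
      refine ⟨fun hK => ⟨a, b, hab, hK, rfl, rfl⟩, ?_⟩
      rintro ⟨a', b', -, hK, ha, hb⟩
      rwa [← Fin.ext ha, ← Fin.ext hb]
    intro a b hab
    rw [h1 G a b hab, h1 G' a b hab, h]
  ext a b
  rcases lt_trichotomy a b with hab | rfl | hab
  · exact key a b hab
  · simp
  · rw [G.adj_comm, G'.adj_comm]
    exact key b a hab

theorem mem_of_contains_upperMatrix {P : Set OrderedGraph} (hP : IsMonotone P) {n k : ℕ}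
    {G : SimpleGraph (Fin n)} (hG : ofFin G ∈ P) {π : Equiv.Perm (Fin k)}
    (h : PermPattern.Contains (cornerPerm π) (upperMatrix G)) : H π ∈ P := by
  obtain ⟨r, c, hr, hc, h⟩ := h
  have hcorner := h (Fin.last k)
  rw [cornerPerm_last, mem_upperMatrix] at hcorner
  have hrc : r (Fin.last k) < c 0 := by
    obtain ⟨a, b, hab, -, ha, hb⟩ := hcorner
    rw [← ha, ← hb]
    exact hab
  have hedge : ∀ i : Fin k, ∃ a b : Fin n, G.Adj a b ∧ (a : ℕ) = r i.castSucc ∧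
      (b : ℕ) = c (π i).succ := by
    intro i
    have h1 := h i.castSucc
    rw [cornerPerm_castSucc, mem_upperMatrix] at h1
    obtain ⟨a, b, -, hab, ha, hb⟩ := h1
    exact ⟨a, b, hab, ha, hb⟩
  choose a b hab ha hb using hedge
  -- The first k vertices go to the rows of the pattern, the last k to its columns other than column
  -- 0.
  let f : Fin (2 * k) → Fin n := fun v =>
    if hv : (v : ℕ) < k then a ⟨v, hv⟩ else b (π.symm ⟨v - k, by omega⟩)
  have hfa : ∀ (v : Fin (2 * k)) (i : Fin k), (v : ℕ) = i → f v = a i := by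
    intro v i hv
    have h1 : (v : ℕ) < k := by omega
    simp only [f, dif_pos h1]
    congr 1
    exact Fin.ext hv
  have hfb : ∀ (v : Fin (2 * k)) (i : Fin k), (v : ℕ) = π i + k → f v = b i := by
    intro v i hv
    have h1 : ¬ (v : ℕ) < k := by omega
    simp only [f, dif_neg h1]
    congr 1
    rw [Equiv.symm_apply_eq]
    ext
    dsimp only
    omega
  refine mem_of_embedding hP hG (G := H π) f ?_ ?_
  · intro (u : Fin (2 * k)) (v : Fin (2 * k)) (huv : (u : ℕ) < (v : ℕ))
    change (f u : ℕ) < (f v : ℕ)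
    by_cases hv : (v : ℕ) < k
    · rw [hfa v ⟨v, hv⟩ rfl, hfa u ⟨u, by omega⟩ rfl, ha, ha]
      exact hr huv
    · have h2 : (v : ℕ) - k < k := by have := v.2; omega
      rw [hfb v (π.symm ⟨v - k, h2⟩) (by rw [Equiv.apply_symm_apply]; dsimp only; omega), hb,
        Equiv.apply_symm_apply]
      by_cases hu : (u : ℕ) < k
      · rw [hfa u ⟨u, hu⟩ rfl, ha]
        calc r (Fin.castSucc ⟨u, hu⟩) < r (Fin.last k) := hr (Fin.castSucc_lt_last _)
          _ < c 0 := hrc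
          _ < c (Fin.succ ⟨v - k, h2⟩) := hc (Fin.succ_pos _)
      · have h3 : (u : ℕ) - k < k := by omega
        rw [hfb u (π.symm ⟨u - k, h3⟩) (by rw [Equiv.apply_symm_apply]; dsimp only; omega), hb,
          Equiv.apply_symm_apply]
        refine hc (Fin.succ_lt_succ_iff.2 ?_)
        rw [Fin.lt_def]
        dsimp only
        omega
  · intro u v huv
    change G.Adj (f u) (f v)
    obtain ⟨i, ⟨h1, h2⟩ | ⟨h1, h2⟩⟩ := H_adj.1 huv
    · rw [hfa u i h1, hfb v i h2]
      exact hab i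
    · rw [hfa v i h1, hfb u i h2]
      exact (hab i).symm

theorem upperMatrix_subset {n : ℕ} (G : SimpleGraph (Fin n)) :
    upperMatrix G ⊆ Finset.range n ×ˢ Finset.range n := by
  rintro ⟨x, y⟩ h
  obtain ⟨a, b, -, -, rfl, rfl⟩ := mem_upperMatrix.1 h
  simp

/-- A monotone property of super-exponential speed contains `H π` for all permutations `π`. -/
theorem H_mem_of_superExponential {P : Set OrderedGraph} (hP : IsMonotone P)
    (hS : SuperExponential P) {k : ℕ} (π : Equiv.Perm (Fin k)) : H π ∈ P := by
  by_contra hπ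
  obtain ⟨c, hc, h⟩ := PermPattern.exists_card_avoiders_le (cornerPerm π)
  obtain ⟨N, hN⟩ := hS c (by exact_mod_cast hc)
  have h1 : speed P N ≤ c ^ N := by
    refine le_trans ?_ (h N)
    rw [speed_eq_ncard_finGraphs hP.1, ← Set.ncard_coe_finset]
    refine Set.ncard_le_ncard_of_injOn upperMatrix (fun G hG => ?_)
      (upperMatrix_injective N).injOn (Finset.finite_toSet _)
    rw [Finset.mem_coe, PermPattern.mem_avoiders]
    exact ⟨upperMatrix_subset G, fun hcon => hπ (mem_of_contains_upperMatrix hP hG hcon)⟩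
  have h2 : (speed P N : ℝ) ≤ (c : ℝ) ^ N := by exact_mod_cast h1
  linarith

end OrderedGraph

/-! ### Growth of `minSpeed`. -/

namespace OrderedGraph

open Filter Asymptotics

theorem factorial_half_le_minSpeed (n : ℕ) : (n / 2).factorial ≤ minSpeed n := by
  have h1 : n.choose (2 * (n / 2)) * (n / 2).factorial ≤ minSpeed n :=
    Finset.single_le_sum (f := fun k => n.choose (2 * k) * k.factorial) (fun _ _ => Nat.zero_le _)
      (Finset.mem_range.2 (Nat.lt_succ_self _))
  exact (Nat.le_mul_of_pos_left _ (Nat.choose_pos (Nat.mul_div_le n 2))).trans h1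

theorem minSpeed_pos (n : ℕ) : 0 < minSpeed n :=
  (Nat.factorial_pos _).trans_le (factorial_half_le_minSpeed n)

theorem minSpeed_le (n : ℕ) : minSpeed n ≤ 2 ^ n * n ^ (n / 2) := by
  rw [← Nat.sum_range_choose, Finset.sum_mul, minSpeed]
  calc ∑ k ∈ Finset.range (n / 2 + 1), n.choose (2 * k) * k.factorial
      ≤ ∑ k ∈ Finset.range (n / 2 + 1), n.choose (2 * k) * n ^ (n / 2) := by
        refine Finset.sum_le_sum fun k hk => Nat.mul_le_mul_left _ ?_
        have hk : k ≤ n / 2 := Nat.lt_succ_iff.1 (Finset.mem_range.1 hk)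
        rcases Nat.eq_zero_or_pos n with rfl | hn
        · obtain rfl : k = 0 := by omega
          simp
        · calc k.factorial ≤ k ^ k := Nat.factorial_le_pow k
            _ ≤ n ^ k := Nat.pow_le_pow_left (by omega) k
            _ ≤ n ^ (n / 2) := Nat.pow_le_pow_right hn hk
    _ = ∑ m ∈ (Finset.range (n / 2 + 1)).image (2 * ·), n.choose m * n ^ (n / 2) := by
        rw [Finset.sum_image]
        intro a _ b _ hab
        exact Nat.eq_of_mul_eq_mul_left two_pos hab
    _ ≤ _ := by
        refine Finset.sum_le_sum_of_subset fun m hm => ?_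
        obtain ⟨k, hk, rfl⟩ := Finset.mem_image.1 hm
        rw [Finset.mem_range] at hk ⊢
        omega

theorem superExponential_of_minSpeed_le {P : Set OrderedGraph}
    (h : ∀ n, minSpeed n ≤ speed P n) : SuperExponential P := by
  intro c hc
  -- Take N = 2m with (c²)^m < m!.
  obtain ⟨m, hm⟩ := ((FloorSemiring.tendsto_pow_div_factorial_atTop (c ^ 2)).eventually
    (gt_mem_nhds one_pos)).exists
  rw [div_lt_one (by positivity), ← pow_mul] at hm
  refine ⟨2 * m, hm.trans_le ?_⟩
  have h1 := (factorial_half_le_minSpeed (2 * m)).trans (h (2 * m))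
  rw [Nat.mul_div_cancel_left m two_pos] at h1
  exact_mod_cast h1

theorem log_minSpeed_le {n : ℕ} (hn : 1 ≤ n) :
    Real.log (minSpeed n) ≤ n / 2 * Real.log n + n := by
  have hn' : (0 : ℝ) < n := by exact_mod_cast hn
  have h0 : (0 : ℝ) ≤ Real.log n := Real.log_natCast_nonneg n
  have h1 : (minSpeed n : ℝ) ≤ 2 ^ n * n ^ (n / 2) := by exact_mod_cast minSpeed_le n
  have h2 := Real.log_le_log (by exact_mod_cast minSpeed_pos n) h1
  rw [Real.log_mul (by positivity) (by positivity), Real.log_pow, Real.log_pow] at h2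
  have h3 : ((n / 2 : ℕ) : ℝ) ≤ n / 2 := Nat.cast_div_le
  have h4 := mul_le_mul_of_nonneg_right h3 h0
  have h5 : (n : ℝ) * Real.log 2 ≤ n * 1 :=
    mul_le_mul_of_nonneg_left (by linarith [Real.log_two_lt_d9]) hn'.le
  linarith

/-- Follows from m! ≥ (m/e)^m with m = ⌊n/2⌋; replacing log m by log n and m by n/2 costs only O(n).
-/
theorem le_log_minSpeed {n : ℕ} (hn : 2 ≤ n) :
    n / 2 * Real.log n - 3 * n ≤ Real.log (minSpeed n) := by
  have hn' : (2 : ℝ) ≤ n := by exact_mod_cast hn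
  set m := n / 2 with hm
  have hm1 : (1 : ℝ) ≤ m := by exact_mod_cast (by omega : 1 ≤ m)
  have h3 : (n : ℝ) ≤ 3 * m := by exact_mod_cast (by omega : n ≤ 3 * m)
  have h2 : (n : ℝ) ≤ 2 * m + 1 := by exact_mod_cast (by omega : n ≤ 2 * m + 1)
  have h2' : 2 * (m : ℝ) ≤ n := by exact_mod_cast (by omega : 2 * m ≤ n)
  have hfac : (m : ℝ) ^ m / m.factorial ≤ Real.exp m :=
    Real.pow_div_factorial_le_exp _ (by positivity) _
  rw [div_le_iff₀ (by positivity)] at hfac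
  have h4 := Real.log_le_log (by positivity) hfac
  rw [Real.log_mul (by positivity) (by positivity), Real.log_exp, Real.log_pow] at h4
  have h5 : Real.log (m.factorial) ≤ Real.log (minSpeed n) :=
    Real.log_le_log (by positivity) (by exact_mod_cast factorial_half_le_minSpeed n)
  have h6 : Real.log n ≤ Real.log 3 + Real.log m := by
    rw [← Real.log_mul (by norm_num) (by positivity)]
    exact Real.log_le_log (by positivity) h3
  have h7 : Real.log 3 ≤ 2 := by
    have := Real.log_le_sub_one_of_pos (show (0 : ℝ) < 3 by norm_num)
    linarith
  have h8 : Real.log n ≤ n - 1 := Real.log_le_sub_one_of_pos (by positivity)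
  have h9 : (m : ℝ) * Real.log n ≤ m * (2 + Real.log m) :=
    mul_le_mul_of_nonneg_left (by linarith) (by positivity)
  have h10 : (n : ℝ) / 2 * Real.log n ≤ (m + 1 / 2) * Real.log n :=
    mul_le_mul_of_nonneg_right (by linarith) (Real.log_natCast_nonneg n)
  linarith

/-- `minSpeed n = n ^ (n / 2 + o(n))`. -/
theorem exists_isLittleO_minSpeed_eq_rpow :
    ∃ ε : ℕ → ℝ, ε =o[atTop] (fun n : ℕ => (n : ℝ)) ∧
      ∀ n : ℕ, 1 ≤ n → (minSpeed n : ℝ) = (n : ℝ) ^ ((n : ℝ) / 2 + ε n) := by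
  -- The exponent is solved for by logarithms, so the error is O(n / log n). At n = 1 the division
  -- by log 1 = 0 is harmless, since 1 to any power is 1.
  refine ⟨fun n => Real.log (minSpeed n) / Real.log n - n / 2, ?_, ?_⟩
  · have hlog : Tendsto (fun n : ℕ => (Real.log n)⁻¹) atTop (nhds 0) :=
      (Real.tendsto_log_atTop.comp tendsto_natCast_atTop_atTop).inv_tendsto_atTop
    have hlo : (fun n : ℕ => (Real.log n)⁻¹ * (n : ℝ)) =o[atTop] (fun n : ℕ => (n : ℝ)) := by
      simpa using ((isLittleO_one_iff ℝ).2 hlog).mul_isBigO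
        (isBigO_refl (fun n : ℕ => (n : ℝ)) atTop)
    refine IsBigO.trans_isLittleO ?_ hlo
    refine IsBigO.of_bound 3 ?_
    filter_upwards [eventually_ge_atTop 2] with n hn
    have hn' : (2 : ℝ) ≤ n := by exact_mod_cast hn
    have hl : 0 < Real.log n := Real.log_pos (by linarith)
    have h1 := log_minSpeed_le (n := n) (by omega)
    have h2 := le_log_minSpeed hn
    have h3 : Real.log (minSpeed n) / Real.log n - n / 2 =
        (Real.log n)⁻¹ * (Real.log (minSpeed n) - n / 2 * Real.log n) := by
      field_simp
    rw [h3, norm_mul, norm_mul, mul_left_comm, Real.norm_eq_abs, Real.norm_eq_abs, Real.norm_eq_abs]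
    refine mul_le_mul_of_nonneg_left ?_ (abs_nonneg _)
    rw [Nat.abs_cast, abs_le]
    constructor <;> linarith
  · intro n hn
    rcases hn.eq_or_lt with rfl | hn
    · simp [minSpeed]
    · have hn' : (1 : ℝ) < n := by exact_mod_cast hn
      have hl := Real.log_pos hn'
      rw [add_sub_cancel, Real.rpow_def_of_pos (by linarith), mul_div_cancel₀ _ hl.ne',
        Real.exp_log (by exact_mod_cast minSpeed_pos n)]

end OrderedGraph

/-! ### Crossing matchings: embedding, counting and uniqueness. -/

namespace OrderedGraph

open Finset

/-- A graph on a linear order is a crossing matching if each vertex has at most one neighbour and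
each left end of an edge precedes each right end of an edge. -/
def IsCrossingMatching {V : Type*} [LinearOrder V] (G : SimpleGraph V) : Prop :=
  (∀ a b c, G.Adj a b → G.Adj a c → b = c) ∧
    ∀ a b c d, a < b → G.Adj a b → c < d → G.Adj c d → a < d

/-- The property of all crossing matchings. -/
def crossingMatchings : Set OrderedGraph :=
  {G | IsCrossingMatching G.graph}

theorem IsCrossingMatching.of_strictMono {V W : Type*} [LinearOrder V] [LinearOrder W]
    {G : SimpleGraph V} {G' : SimpleGraph W} (h : IsCrossingMatching G') (f : V → W)
    (hf : StrictMono f) (hadj : ∀ a b, G.Adj a b → G'.Adj (f a) (f b)) :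
    IsCrossingMatching G :=
  ⟨fun a b c hab hac => hf.injective (h.1 _ _ _ (hadj a b hab) (hadj a c hac)),
    fun a b c d hab hG hcd hG' => hf.lt_iff_lt.1
      (h.2 _ _ _ _ (hf hab) (hadj a b hG) (hf hcd) (hadj c d hG'))⟩

theorem IsCrossingMatching.map {V W : Type*} [LinearOrder V] [LinearOrder W]
    {G : SimpleGraph V} (h : IsCrossingMatching G) (f : V ↪o W) :
    IsCrossingMatching (G.map f.toEmbedding) := by
  constructor
  · rintro _ _ _ ⟨-, a, b, hab, rfl, rfl⟩ ⟨-, a', c, hac, ha, rfl⟩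
    obtain rfl := f.injective ha
    rw [h.1 _ _ _ hab hac]
  · rintro _ _ _ _ hab ⟨-, a, b, hG, rfl, rfl⟩ hcd ⟨-, c, d, hG', rfl, rfl⟩
    exact f.lt_iff_lt.2 (h.2 _ _ _ _ (f.lt_iff_lt.1 hab) hG (f.lt_iff_lt.1 hcd) hG')

theorem isMonotone_crossingMatchings : IsMonotone crossingMatchings := by
  constructor
  · intro G hG H hGH
    obtain ⟨e, he⟩ := hGH.symm
    exact hG.of_strictMono e e.strictMono fun a b => (he a b).1
  · intro G hG S
    exact hG.of_strictMono (Subtype.val : S.verts → G.V) (fun _ _ h => h) fun a b h => S.adj_sub h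

theorem isCrossingMatching_H {k : ℕ} (π : Equiv.Perm (Fin k)) :
    IsCrossingMatching (V := Fin (2 * k)) (H π).graph := by
  constructor
  · intro a b c hab hac
    obtain ⟨i, ⟨h1, h2⟩ | ⟨h1, h2⟩⟩ := H_adj.1 hab <;>
      obtain ⟨j, ⟨h3, h4⟩ | ⟨h3, h4⟩⟩ := H_adj.1 hac
    · obtain rfl : i = j := Fin.ext (by omega)
      exact Fin.ext (by omega)
    · omega
    · omega
    · obtain rfl : i = j := π.injective (Fin.ext (by omega))
      exact Fin.ext (by omega)
  · intro a b c d hab hG hcd hG'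
    rw [Fin.lt_def] at *
    obtain ⟨i, ⟨h1, h2⟩ | ⟨h1, h2⟩⟩ := H_adj.1 hG <;>
      obtain ⟨j, ⟨h3, h4⟩ | ⟨h3, h4⟩⟩ := H_adj.1 hG' <;> omega

/-- Every crossing matching is an ordered subgraph of some `H π`. -/
theorem exists_embedding_H {n : ℕ} {G : SimpleGraph (Fin n)} (hG : IsCrossingMatching G) :
    ∃ (π : Equiv.Perm (Fin n)) (f : Fin n → Fin (2 * n)), StrictMono f ∧
      ∀ a b, G.Adj a b → (H π).graph.Adj (f a) (f b) := by
  classical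
  let p : {a : Fin n // ∃ b, a < b ∧ G.Adj a b} → Fin n := fun a => a.2.choose
  have hp : ∀ a, a.1 < p a ∧ G.Adj a.1 (p a) := fun a => a.2.choose_spec
  have hpi : Function.Injective p := fun a b hab => by
    have h1 := (hp a).2.symm
    rw [hab] at h1
    exact Subtype.ext (hG.1 _ _ _ h1 (hp b).2.symm)
  obtain ⟨π, hπ⟩ := Equiv.Perm.exists_extending_pair Subtype.val p Subtype.val_injective hpi
  -- Vertices up to the last left end stay in the lower half and the rest shift by n. Every right
  -- end is shifted, because it follows all left ends.
  let f : Fin n → Fin (2 * n) := fun v =>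
    if ∃ a b, a < b ∧ G.Adj a b ∧ v ≤ a then ⟨v, by omega⟩ else ⟨v + n, by omega⟩
  have key : ∀ a b, a < b → G.Adj a b → (H π).graph.Adj (f a) (f b) := by
    intro a b hab hadj
    have h1 : ∃ a' b', a' < b' ∧ G.Adj a' b' ∧ a ≤ a' := ⟨a, b, hab, hadj, le_rfl⟩
    have h2 : ¬ ∃ a' b', a' < b' ∧ G.Adj a' b' ∧ b ≤ a' := by
      rintro ⟨c, d, hcd, hG', hbc⟩
      exact absurd (hG.2 c d a b hcd hG' hab hadj) (not_lt.2 hbc)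
    have h3 : π a = b := (hπ ⟨a, b, hab, hadj⟩).trans
      (hG.1 _ _ _ (hp ⟨a, b, hab, hadj⟩).2 hadj)
    refine H_adj.2 ⟨a, Or.inl ⟨?_, ?_⟩⟩
    · simp only [f, if_pos h1]
    · simp only [f, if_neg h2, h3]
  refine ⟨π, f, ?_, ?_⟩
  · intro u v huv
    simp only [f]
    by_cases hv : ∃ a b, a < b ∧ G.Adj a b ∧ v ≤ a
    · have hu : ∃ a b, a < b ∧ G.Adj a b ∧ u ≤ a := by
        obtain ⟨a, b, h1, h2, h3⟩ := hv
        exact ⟨a, b, h1, h2, huv.le.trans h3⟩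
      rw [if_pos hv, if_pos hu]
      exact huv
    · rw [if_neg hv, Fin.lt_def]
      rw [Fin.lt_def] at huv
      split_ifs <;> dsimp only <;> omega
  · intro a b hab
    rcases lt_or_gt_of_ne hab.ne with h | h
    · exact key a b h hab
    · exact (key b a h hab.symm).symm

theorem crossingMatchings_subset {P : Set OrderedGraph} (hP : IsMonotone P)
    (hH : ∀ (k : ℕ) (π : Equiv.Perm (Fin k)), H π ∈ P) : crossingMatchings ⊆ P := by
  intro G hG
  obtain ⟨G', h⟩ := exists_isomorphic_ofFin G
  obtain ⟨π, f, hf, hadj⟩ := exists_embedding_H (isMonotone_crossingMatchings.1 G hG _ h)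
  exact hP.1 _ (mem_of_embedding hP (hH _ π) (G := ofFin G') f hf hadj) _ h.symm

theorem crossingMatchings_subset_restrict {P : Set OrderedGraph} (h : crossingMatchings ⊆ P) :
    crossingMatchings ⊆ restrict P 1 2 := by
  intro G hG
  refine ⟨h hG, fun v => ?_, fun e _ => ?_⟩
  · rw [Set.encard_le_one_iff]
    rintro e e' ⟨he, hv⟩ ⟨he', hv'⟩
    obtain ⟨a, rfl⟩ := hv
    obtain ⟨b, rfl⟩ := hv'
    rw [hG.1 v a b he he']
  · induction e with
    | _ a b =>
      have : {v : G.V | v ∈ s(a, b)} = {a, b} := by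
        ext v
        simp
      rw [this]
      refine (Set.encard_insert_le _ _).trans ?_
      rw [Set.encard_singleton, one_add_one_eq_two]

theorem exists_partner {m : ℕ} {G : SimpleGraph (Fin m)} (hG : IsCrossingMatching G)
    (hfull : ∀ v, ∃ w, G.Adj v w) :
    ∃ p : Fin m → Fin m, (∀ a b, G.Adj a b ↔ p a = b) ∧ (∀ a, p (p a) = a) ∧ ∀ a, p a ≠ a := by
  choose p hp using hfull
  refine ⟨p, fun a b => ⟨fun h => hG.1 _ _ _ (hp a) h, fun h => h ▸ hp a⟩,
    fun a => hG.1 _ _ _ (hp (p a)) (hp a).symm, fun a => (hp a).ne'⟩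

theorem eq_two_mul_card {m : ℕ} {p : Fin m → Fin m} (hp : ∀ a, p (p a) = a)
    (hne : ∀ a, p a ≠ a) : m = 2 * #{a | a < p a} := by
  have hR : #{a | ¬ a < p a} = #{a | a < p a} := by
    refine card_bij' (fun a _ => p a) (fun a _ => p a) ?_ ?_ (fun a _ => hp a) fun a _ => hp a
    · intro a ha
      simp only [mem_filter_univ, not_lt] at ha ⊢
      rw [hp]
      exact lt_of_le_of_ne ha (hne a)
    · intro a ha
      simp only [mem_filter_univ, not_lt] at ha ⊢
      rw [hp]
      exact ha.le
  have h := card_filter_add_card_filter_not (s := (univ : Finset (Fin m))) (fun a => a < p a)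
  rw [hR, card_univ, Fintype.card_fin] at h
  omega

/-- A crossing matching without isolated vertices is `H π` for some `π`. -/
theorem exists_eq_H {k : ℕ} {G : SimpleGraph (Fin (2 * k))} (hG : IsCrossingMatching G)
    (hfull : ∀ v, ∃ w, G.Adj v w) : ∃ π : Equiv.Perm (Fin k), (H π).graph = G := by
  obtain ⟨p, hadj, hp, hne⟩ := exists_partner hG hfull
  have hcard : #{a | a < p a} = k := by
    have := eq_two_mul_card hp hne
    omega
  -- The left ends form an initial segment: a right end cannot precede a left end. Having k
  -- elements, the segment is {a < k}.
  have hlow : ∀ a b, b < p b → a < b → a < p a := by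
    intro a b hb hab
    by_contra ha
    have h1 : p a < a := lt_of_le_of_ne (not_lt.1 ha) (hne a)
    exact absurd (hG.2 b (p b) (p a) a hb ((hadj _ _).2 rfl) h1 ((hadj _ _).2 (hp a)))
      (not_lt.2 hab.le)
  have hiff : ∀ a, a < p a ↔ (a : ℕ) < k := by
    intro a
    constructor
    · intro ha
      have h1 : Iic a ⊆ ({a | a < p a} : Finset (Fin (2 * k))) := fun b hb => by
        rw [mem_filter_univ]
        rcases (mem_Iic.1 hb).eq_or_lt with rfl | h
        · exact ha
        · exact hlow b a ha h
      have h2 := card_le_card h1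
      rw [Fin.card_Iic, hcard] at h2
      omega
    · intro ha
      by_contra h
      have h1 : ({a | a < p a} : Finset (Fin (2 * k))) ⊆ Iio a := fun b hb => by
        rw [mem_filter_univ] at hb
        rw [mem_Iio]
        by_contra hba
        rcases (not_lt.1 hba).eq_or_lt with rfl | hlt
        · exact h hb
        · exact h (hlow a b hb hlt)
      have h2 := card_le_card h1
      rw [Fin.card_Iio, hcard] at h2
      omega
  have hsw : ∀ a, (p a : ℕ) < k ↔ k ≤ (a : ℕ) := by
    intro a
    rw [← hiff, ← not_lt, ← hiff, hp, not_lt]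
    exact ⟨le_of_lt, fun h => lt_of_le_of_ne h (hne a)⟩
  let g : Fin k → Fin k := fun i => ⟨(p ⟨i, by omega⟩ : ℕ) - k, by omega⟩
  have hg : ∀ (i : Fin k) (x : Fin (2 * k)), (x : ℕ) = i → (p x : ℕ) = g i + k := by
    intro i x hx
    have hx' : (⟨i, by omega⟩ : Fin (2 * k)) = x := Fin.ext hx.symm
    have h1 := hsw x
    simp only [g, hx']
    omega
  have hgi : Function.Injective g := by
    intro i j hij
    have h1 := hg i ⟨i, by omega⟩ rfl
    have h2 := hg j ⟨j, by omega⟩ rfl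
    rw [hij] at h1
    have h3 := congrArg p (Fin.ext (h1.trans h2.symm))
    rw [hp, hp] at h3
    exact Fin.ext (Fin.mk.inj h3)
  refine ⟨Equiv.ofBijective g (Finite.injective_iff_bijective.1 hgi), ?_⟩
  refine SimpleGraph.ext
    (funext fun (x : Fin (2 * k)) => funext fun (y : Fin (2 * k)) => propext ?_)
  refine H_adj.trans (Iff.trans ?_ (hadj x y).symm)
  constructor
  · rintro ⟨i, ⟨h1, h2⟩ | ⟨h1, h2⟩⟩
    · exact Fin.ext ((hg i x h1).trans h2.symm)
    · rw [← hp y]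
      exact congrArg p (Fin.ext (h2.trans (hg i y h1).symm))
  · rintro rfl
    by_cases hx : (x : ℕ) < k
    · exact ⟨⟨x, hx⟩, Or.inl ⟨rfl, hg _ x rfl⟩⟩
    · have h1 := (hsw x).2 (not_lt.1 hx)
      refine ⟨⟨p x, h1⟩, Or.inr ⟨rfl, ?_⟩⟩
      have h2 := hg ⟨p x, h1⟩ (p x) rfl
      rw [hp] at h2
      exact h2

/-- The graph `H π` placed on the vertices of `S`, with all other vertices isolated. -/
def placeH {n k : ℕ} (S : {S : Finset (Fin n) // #S = 2 * k}) (π : Equiv.Perm (Fin k)) :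
    SimpleGraph (Fin n) :=
  SimpleGraph.map (V := Fin (2 * k)) (S.1.orderEmbOfFin S.2).toEmbedding (H π).graph

theorem exists_H_adj {k : ℕ} (π : Equiv.Perm (Fin k)) (x : Fin (2 * k)) :
    ∃ y : Fin (2 * k), (H π).graph.Adj x y := by
  by_cases hx : (x : ℕ) < k
  · exact ⟨⟨π ⟨x, hx⟩ + k, by omega⟩, H_adj.2 ⟨⟨x, hx⟩, Or.inl ⟨rfl, rfl⟩⟩⟩
  · refine ⟨⟨π.symm ⟨x - k, by omega⟩, by omega⟩,
      H_adj.2 ⟨π.symm ⟨x - k, by omega⟩, Or.inr ⟨rfl, ?_⟩⟩⟩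
    rw [Equiv.apply_symm_apply]
    dsimp only
    omega

theorem H_graph_injective {k : ℕ} {π π' : Equiv.Perm (Fin k)}
    (h : ∀ x y : Fin (2 * k), (H π).graph.Adj x y ↔ (H π').graph.Adj x y) : π = π' := by
  ext i
  have h1 := (h ⟨i, by omega⟩ ⟨π i + k, by omega⟩).1 (H_adj.2 ⟨i, Or.inl ⟨rfl, rfl⟩⟩)
  obtain ⟨j, ⟨h2, h3⟩ | ⟨h2, h3⟩⟩ := H_adj.1 h1
  · obtain rfl : i = j := Fin.ext h2
    dsimp only at h3
    omega
  · dsimp only at h3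
    omega

theorem placeH_adj {n k : ℕ} (S : {S : Finset (Fin n) // #S = 2 * k}) (π : Equiv.Perm (Fin k))
    (x y : Fin (2 * k)) : (placeH S π).Adj (S.1.orderEmbOfFin S.2 x) (S.1.orderEmbOfFin S.2 y) ↔
      (H π).graph.Adj x y :=
  SimpleGraph.map_adj_apply (V := Fin (2 * k))

theorem mem_iff_exists_placeH_adj {n k : ℕ} (S : {S : Finset (Fin n) // #S = 2 * k})
    (π : Equiv.Perm (Fin k)) (v : Fin n) : v ∈ S.1 ↔ ∃ w, (placeH S π).Adj v w := by
  constructor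
  · intro hv
    rw [← Finset.mem_coe, ← S.1.range_orderEmbOfFin S.2] at hv
    obtain ⟨x, rfl⟩ := hv
    obtain ⟨y, hy⟩ := exists_H_adj π x
    exact ⟨_, (placeH_adj S π x y).2 hy⟩
  · rintro ⟨w, hw⟩
    obtain ⟨x, y, -, rfl, -⟩ := (SimpleGraph.map_adj (V := Fin (2 * k)) _ _ _ _).1 hw
    exact S.1.orderEmbOfFin_mem S.2 x

/-- The possible positions of the non-isolated vertices of a crossing matching, each with a
permutation. -/
abbrev Placement (n : ℕ) : Type :=
  Σ k : Fin (n / 2 + 1), {S : Finset (Fin n) // #S = 2 * (k : ℕ)} × Equiv.Perm (Fin k)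

theorem card_placement (n : ℕ) : Nat.card (Placement n) = minSpeed n := by
  rw [Nat.card_eq_fintype_card, Fintype.card_sigma, minSpeed,
    ← Fin.sum_univ_eq_sum_range fun k => n.choose (2 * k) * k.factorial]
  refine Finset.sum_congr rfl fun k _ => ?_
  rw [Fintype.card_prod, Fintype.card_finset_len, Fintype.card_perm, Fintype.card_fin,
    Fintype.card_fin]

/-- The graph determines S as its set of non-isolated vertices, then k from #S, then π from the
edges. -/
theorem placeH_injective (n : ℕ) :
    Function.Injective fun x : Placement n => placeH x.2.1 x.2.2 := by
  rintro ⟨k, S, π⟩ ⟨k', S', π'⟩ h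
  dsimp only at h
  have hS : S.1 = S'.1 := by
    ext v
    rw [mem_iff_exists_placeH_adj S π, mem_iff_exists_placeH_adj S' π', h]
  obtain rfl : k = k' := Fin.ext (by
    have h1 := S.2
    have h2 := S'.2
    rw [hS] at h1
    omega)
  obtain rfl : S = S' := Subtype.ext hS
  have hπ : π = π' := H_graph_injective fun x y => by
    rw [← placeH_adj S π, h, placeH_adj]
  rw [hπ]

theorem exists_placeH_eq {n : ℕ} {G : SimpleGraph (Fin n)} (hG : IsCrossingMatching G) :
    ∃ x : Placement n, placeH x.2.1 x.2.2 = G := by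
  classical
  set S : Finset (Fin n) := {v | ∃ w, G.Adj v w} with hS
  have hmem : ∀ v w, G.Adj v w → v ∈ S := fun v w h => by
    rw [hS, mem_filter_univ]
    exact ⟨w, h⟩
  -- Stated for any m equal to #S: used with m = #S to see that #S is even, then with m = 2k.
  have hcross : ∀ (m : ℕ) (hm : #S = m),
      IsCrossingMatching (G.comap (S.orderEmbOfFin hm)) := fun m hm =>
    hG.of_strictMono _ (S.orderEmbOfFin hm).strictMono fun _ _ h => h
  have hfull : ∀ (m : ℕ) (hm : #S = m) (v : Fin m),
      ∃ w, (G.comap (S.orderEmbOfFin hm)).Adj v w := by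
    intro m hm v
    have h1 := S.orderEmbOfFin_mem hm v
    obtain ⟨w, hw⟩ := (mem_filter_univ _).1 h1
    have h2 : w ∈ Set.range (S.orderEmbOfFin hm) := by
      rw [S.range_orderEmbOfFin hm]
      exact hmem w _ hw.symm
    obtain ⟨w, rfl⟩ := h2
    exact ⟨w, hw⟩
  obtain ⟨k, hk⟩ : ∃ k, #S = 2 * k := by
    obtain ⟨p, -, hp, hne⟩ := exists_partner (hcross _ rfl) (hfull _ rfl)
    exact ⟨_, eq_two_mul_card hp hne⟩
  obtain ⟨π, hπ⟩ := exists_eq_H (hcross _ hk) (hfull _ hk)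
  have hkn : k < n / 2 + 1 := by
    have := card_le_univ S
    rw [Fintype.card_fin] at this
    omega
  refine ⟨⟨⟨k, hkn⟩, ⟨S, hk⟩, π⟩, ?_⟩
  have h0 : placeH ⟨S, hk⟩ π =
      (G.comap (S.orderEmbOfFin hk)).map (S.orderEmbOfFin hk).toEmbedding := by
    rw [← hπ]
    rfl
  refine h0.trans ?_
  ext a b
  rw [SimpleGraph.map_adj]
  constructor
  · rintro ⟨x, y, hxy, rfl, rfl⟩
    exact hxy
  · intro hab
    have h1 : ∀ v ∈ S, v ∈ Set.range (S.orderEmbOfFin hk) := fun v hv => by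
      rw [S.range_orderEmbOfFin hk]
      exact hv
    obtain ⟨x, rfl⟩ := h1 a (hmem a b hab)
    obtain ⟨y, rfl⟩ := h1 b (hmem b _ hab.symm)
    exact ⟨x, y, hab, rfl, rfl⟩

theorem speed_crossingMatchings (n : ℕ) : speed crossingMatchings n = minSpeed n := by
  rw [speed_eq_ncard_finGraphs isMonotone_crossingMatchings.1, ← card_placement,
    ← Nat.card_range_of_injective (placeH_injective n), Nat.card_coe_set_eq]
  congr 1
  ext G
  constructor
  · exact fun hG => exists_placeH_eq hG
  · rintro ⟨x, rfl⟩
    exact (isCrossingMatching_H x.2.2).map _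

theorem eq_crossingMatchings {Q : Set OrderedGraph} (hQ : IsMonotone Q)
    (h : ∀ n, speed Q n = minSpeed n) : Q = crossingMatchings := by
  have hsub : crossingMatchings ⊆ Q := crossingMatchings_subset hQ fun k π =>
    H_mem_of_superExponential hQ (superExponential_of_minSpeed_le fun n => (h n).ge) π
  refine Set.Subset.antisymm (fun G hG => ?_) hsub
  obtain ⟨G', hiso⟩ := exists_isomorphic_ofFin G
  have heq : finGraphs crossingMatchings (Nat.card G.V) = finGraphs Q (Nat.card G.V) := by
    refine Set.eq_of_subset_of_ncard_le (fun K hK => hsub hK) ?_ (Set.toFinite _)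
    rw [← speed_eq_ncard_finGraphs hQ.1,
      ← speed_eq_ncard_finGraphs isMonotone_crossingMatchings.1, h, speed_crossingMatchings]
  have h1 : G' ∈ finGraphs Q (Nat.card G.V) := hQ.1 G hG _ hiso
  rw [← heq] at h1
  exact isMonotone_crossingMatchings.1 _ h1 _ hiso.symm

end OrderedGraph

theorem mainTheorem4 :
    (∀ P : Set OrderedGraph, OrderedGraph.IsMonotone P → OrderedGraph.SuperExponential P →
      (∀ (k : ℕ) (π : Equiv.Perm (Fin k)), OrderedGraph.H π ∈ P) ∧
      (∀ n : ℕ,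
        OrderedGraph.speed (OrderedGraph.restrict P 1 2) n ≤ OrderedGraph.speed P n ∧
        OrderedGraph.minSpeed n ≤ OrderedGraph.speed (OrderedGraph.restrict P 1 2) n)) ∧
    (∃ ε : ℕ → ℝ, ε =o[Filter.atTop] (fun n : ℕ => (n : ℝ)) ∧
      ∀ n : ℕ, 1 ≤ n → (OrderedGraph.minSpeed n : ℝ) = (n : ℝ) ^ ((n : ℝ) / 2 + ε n)) ∧
    (∃ P : Set OrderedGraph, OrderedGraph.IsMonotone P ∧ OrderedGraph.SuperExponential P ∧
      ∀ n : ℕ, OrderedGraph.speed P n = OrderedGraph.minSpeed n) ∧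
    (∃! P : Set OrderedGraph, OrderedGraph.IsMonotone P ∧
      ∀ n : ℕ, OrderedGraph.speed P n = OrderedGraph.minSpeed n) := by
  refine ⟨fun P hP hS => ?_, OrderedGraph.exists_isLittleO_minSpeed_eq_rpow,
    ⟨OrderedGraph.crossingMatchings, OrderedGraph.isMonotone_crossingMatchings,
      OrderedGraph.superExponential_of_minSpeed_le fun n =>
        (OrderedGraph.speed_crossingMatchings n).ge, OrderedGraph.speed_crossingMatchings⟩,
    ⟨OrderedGraph.crossingMatchings,
      ⟨OrderedGraph.isMonotone_crossingMatchings, OrderedGraph.speed_crossingMatchings⟩,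
      fun Q hQ => OrderedGraph.eq_crossingMatchings hQ.1 hQ.2⟩⟩
  have hH : ∀ (k : ℕ) (π : Equiv.Perm (Fin k)), OrderedGraph.H π ∈ P := fun k π =>
    OrderedGraph.H_mem_of_superExponential hP hS π
  refine ⟨hH, fun n => ⟨OrderedGraph.speed_mono (fun G hG => hG.1) n, ?_⟩⟩
  rw [← OrderedGraph.speed_crossingMatchings]
  exact OrderedGraph.speed_mono (OrderedGraph.crossingMatchings_subset_restrict
    (OrderedGraph.crossingMatchings_subset hP hH)) n
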